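/- Let $V$ be a Euclidean space and let $\Phi\subset V$ be a reduced, irreducible, crystallographic root system spanning $V$ (the root system of a compact simple Lie group), with simple roots $\alpha_1,\dots,\alpha_n$, coroots $\alpha_i^\vee=2\alpha_i/\langle\alpha_i,\alpha_i\rangle$ and highest root $\xi=m_1\alpha_1+\dots+m_n\alpha_n$. Let $m=1+m_1+\dots+m_n$ be the Coxeter number. Put $$P^\vee=\{x\in V:\langle x,\alpha_i\rangle\in\mathbb Z,\ i=1,\dots,n\},\qquad Q^\vee=\mathbb Z\alpha_1^\vee+\dots+\mathbb Z\alpha_n^\vee,$$ $$F=\{a\in V:\langle a,\alpha_i\rangle\ge 0,\ i=1,\dots,n,\ \langle a,\xi\rangle\le 1\},\qquad F^e=F\cup r_j\,\mathrm{int}(F),$$ where $j\in\{1,\dots,n\}$ is fixed and $r_j$ is the orthogonal reflection $r_ja=a-\langle a,\alpha_j^\vee\rangle\alpha_j$. For an integer $M\ge 1$ let $F_M$ (respectively $F^e_M$) be the set of those cosets in $\frac1M P^\vee/Q^\vee$ that have a representative in $F$ (respectively in $F^e$). Then $F_M$ and $F^e_M$ are finite and $$|F^e_M|=\begin{cases}|F_M|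 & M<m,\\ |F_M|+1 & M=m,\\ |F_M|+|F_{M-m}| & M>m.\end{cases}$$ -/

import Mathlib

open scoped Pointwise InnerProductSpace

noncomputable section

namespace EvenGrid

variable {ι V : Type*} [NormedAddCommGroup V] [InnerProductSpace ℝ V]

/-- A root pairing of a Euclidean space with itself is a Euclidean root system when the pairing is
the inner product and every coroot is `α^∨ = 2α / ⟨α, α⟩`. The map `P.reflection i` is then the
orthogonal reflection `r_α a = a - (2⟨a, α⟩ / ⟨α, α⟩) α` for `α = P.root i`. -/
structure IsEuclidean (P : RootPairing ι ℝ V V) : Prop where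
  toLinearMap_apply (x y : V) : P.toLinearMap x y = ⟪x, y⟫_ℝ
  coroot_eq (i : ι) : P.coroot i = (2 / ⟪P.root i, P.root i⟫_ℝ) • P.root i

variable {P : RootPairing ι ℝ V V}

/-- `P.root ξ` is the highest root: the root of greatest height `∑ zᵢ`, where
`∑ zᵢ αᵢ` is the expansion of a root in the simple roots. -/
def IsHighestRoot (b : P.Base) (ξ : ι) : Prop :=
  ∀ k : ι, b.height k ≤ b.height ξ

/-- The mark `mᵢ`: the coefficient of the simple root `αᵢ` in the highest root. (These integer
coefficients are nonnegative, so taking them as natural numbers loses nothing; see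
`root_eq_sum_mark`.) -/
def mark (b : P.Base) (ξ : ι) (i : b.support) : ℕ :=
  (b.toWeightBasisInt.repr (P.rootSpanMem ℤ ξ) i).toNat

/-- The Coxeter number `m = 1 + m₁ + ⋯ + mₙ`. -/
def coxeterNumber (b : P.Base) (ξ : ι) : ℕ :=
  1 + ∑ i : b.support, mark b ξ i

/-- The dual weight lattice `P^∨ = {x | ⟨x, α⟩ ∈ ℤ for all simple roots α}`. -/
def dualWeightLattice (b : P.Base) : AddSubgroup V where
  carrier := {x | ∀ i ∈ b.support, ∃ z : ℤ, ⟪x, P.root i⟫_ℝ = z}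
  zero_mem' i _ := ⟨0, by simp⟩
  add_mem' {x y} hx hy i hi := by
    obtain ⟨k, hk⟩ := hx i hi
    obtain ⟨l, hl⟩ := hy i hi
    exact ⟨k + l, by rw [inner_add_left, hk, hl]; push_cast; ring⟩
  neg_mem' {x} hx i hi := by
    obtain ⟨k, hk⟩ := hx i hi
    exact ⟨-k, by rw [inner_neg_left, hk]; push_cast; ring⟩

/-- The dual root lattice `Q^∨ = ℤα₁^∨ + ⋯ + ℤαₙ^∨`. -/
def dualRootLattice (b : P.Base) : AddSubgroup V :=
  AddSubgroup.closure (P.coroot '' b.support)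

/-- The closed simplex `F = {a | ⟨a, α⟩ ≥ 0 for all simple roots α, ⟨a, ξ⟩ ≤ 1}`, the fundamental
region of the affine Weyl group. -/
def fundRegion (b : P.Base) (ξ : ι) : Set V :=
  {a | (∀ i ∈ b.support, 0 ≤ ⟪a, P.root i⟫_ℝ) ∧ ⟪a, P.root ξ⟫_ℝ ≤ 1}

/-- The region `F^e = F ∪ r_j int(F)`. -/
def evenFundRegion (b : P.Base) (ξ j : ι) : Set V :=
  fundRegion b ξ ∪ P.reflection j '' interior (fundRegion b ξ)

/-- The subgroup `(1/M)P^∨ / Q^∨` of the torus `V / Q^∨`. -/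
def gridGroup (b : P.Base) (M : ℕ) : AddSubgroup (V ⧸ dualRootLattice b) :=
  ((M : ℝ)⁻¹ • dualWeightLattice b).map (QuotientAddGroup.mk' (dualRootLattice b))

/-- The cosets in `(1/M)P^∨ / Q^∨` which have a representative in `S`. -/
def gridIn (b : P.Base) (M : ℕ) (S : Set V) : Set (V ⧸ dualRootLattice b) :=
  (gridGroup b M : Set (V ⧸ dualRootLattice b)) ∩ QuotientAddGroup.mk' (dualRootLattice b) '' S

/-- The grid `F_M`. -/
def grid (b : P.Base) (ξ : ι) (M : ℕ) : Set (V ⧸ dualRootLattice b) :=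
  gridIn b M (fundRegion b ξ)

/-- The grid `F^e_M`. -/
def evenGrid (b : P.Base) (ξ j : ι) (M : ℕ) : Set (V ⧸ dualRootLattice b) :=
  gridIn b M (evenFundRegion b ξ j)

/-- The highest root is `m₁α₁ + ⋯ + mₙαₙ`. -/
theorem root_eq_sum_mark (b : P.Base) {ξ : ι} (hξ : IsHighestRoot b ξ) :
    P.root ξ = ∑ i : b.support, mark b ξ i • P.root i := by
  obtain ⟨f, -, h | h⟩ := b.exists_root_eq_sum_nat_or_neg ξ
  · have h2 : P.rootSpanMem ℤ ξ = ∑ i : b.support, (f i : ℤ) • b.toWeightBasisInt i := by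
      apply Subtype.ext
      rw [← Finset.sum_coe_sort b.support (fun i => f i • P.root i)] at h
      simpa using h
    have h3 (i : b.support) : mark b ξ i = f i := by
      simp only [mark]
      rw [h2, Module.Basis.repr_sum_self]
      simp
    simp_rw [h3]
    rw [h, ← Finset.sum_coe_sort b.support (fun i => f i • P.root i)]
  · exfalso
    have h1 : b.height ξ = ∑ i ∈ b.support, -(f i : ℤ) :=
      RootPairing.Base.height_eq_sum (by simpa using h)
    have h2 := hξ (P.reflectionPerm ξ ξ)
    have h3 : b.height (P.reflectionPerm ξ ξ) = -b.height ξ := b.height_reflectionPerm_self ξ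
    have h4 := b.height_ne_zero ξ
    have h5 : 0 ≤ ∑ i ∈ b.support, (f i : ℤ) := Finset.sum_nonneg fun _ _ => by positivity
    rw [Finset.sum_neg_distrib] at h1
    omega

end EvenGrid

end

namespace EvenGrid

variable {ι V : Type*} [NormedAddCommGroup V] [InnerProductSpace ℝ V] {P : RootPairing ι ℝ V V}

/-! Points of `F` in `(1/M)P^∨` are `p/M` with `p ∈ P^∨` dominant of level `⟨p, ξ⟩ ≤ M`. Interior
points are `(p + ρ)/M`, where `ρ` pairs to 1 with every simple root; since `⟨ρ, ξ⟩ = m - 1` and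
levels are integers, `p` now has level at most `M - m`. Hence `r_j int(F)` contributes nothing, one
point, or `|F_{M-m}|` points. This counts cosets because `F^e` injects into `V/Q^∨`
(`injOn_mk_evenFundRegion`): two congruent points differ by some `q ∈ Q^∨` with `|⟨q, α⟩| < 2` for
all roots `α`, and then `q = 0` (`eq_zero_of_abs_inner_root_lt_two`). The bounds on `F` come from
`IsHighestRoot.inner_root_le`. -/

lemma inner_root_self_pos (P : RootPairing ι ℝ V V) (i : ι) :
    0 < ⟪P.root i, P.root i⟫_ℝ :=
  real_inner_self_pos.mpr (P.ne_zero i)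

namespace IsEuclidean

lemma inner_coroot (hP : IsEuclidean P) (x : V) (i : ι) :
    ⟪x, P.coroot i⟫_ℝ = 2 / ⟪P.root i, P.root i⟫_ℝ * ⟪x, P.root i⟫_ℝ := by
  rw [hP.coroot_eq, real_inner_smul_right]

lemma pairing_eq (hP : IsEuclidean P) (i j : ι) :
    P.pairing i j = 2 / ⟪P.root j, P.root j⟫_ℝ * ⟪P.root i, P.root j⟫_ℝ := by
  rw [← hP.inner_coroot, ← hP.toLinearMap_apply, P.root_coroot_eq_pairing]

lemma inner_coroot_root (hP : IsEuclidean P) [P.IsCrystallographic] (i j : ι) :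
    ⟪P.coroot j, P.root i⟫_ℝ = P.pairingIn ℤ i j := by
  rw [real_inner_comm, ← hP.toLinearMap_apply, P.root_coroot_eq_pairing,
    ← P.algebraMap_pairingIn ℤ]
  simp

lemma pairingIn_eq (hP : IsEuclidean P) [P.IsCrystallographic] (i j : ι) :
    (P.pairingIn ℤ i j : ℝ) = 2 / ⟪P.root j, P.root j⟫_ℝ * ⟪P.root i, P.root j⟫_ℝ := by
  rw [← hP.pairing_eq, ← P.algebraMap_pairingIn ℤ]
  simp

lemma pairingIn_pos_iff (hP : IsEuclidean P) [P.IsCrystallographic] (i j : ι) :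
    0 < P.pairingIn ℤ i j ↔ 0 < ⟪P.root i, P.root j⟫_ℝ := by
  rw [← Int.cast_pos (R := ℝ), hP.pairingIn_eq]
  exact mul_pos_iff_of_pos_left (div_pos two_pos (inner_root_self_pos P j))

lemma pairingIn_neg_iff (hP : IsEuclidean P) [P.IsCrystallographic] (i j : ι) :
    P.pairingIn ℤ i j < 0 ↔ ⟪P.root i, P.root j⟫_ℝ < 0 := by
  have h : 0 < 2 / ⟪P.root j, P.root j⟫_ℝ := div_pos two_pos (inner_root_self_pos P j)
  rw [← Int.cast_lt_zero (R := ℝ), hP.pairingIn_eq, mul_neg_iff]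
  constructor
  · rintro (h' | h')
    · exact h'.2
    · exact absurd h h'.1.not_gt
  · exact fun h' => Or.inl ⟨h, h'⟩

lemma reflection_eq (hP : IsEuclidean P) (i : ι) (x : V) :
    P.reflection i x = x - ⟪x, P.root i⟫_ℝ • P.coroot i := by
  rw [P.reflection_apply, LinearMap.flip_apply, hP.toLinearMap_apply, hP.inner_coroot,
    hP.coroot_eq, smul_smul, mul_comm]

lemma inner_reflection_left (hP : IsEuclidean P) (i : ι) (x y : V) :
    ⟪P.reflection i x, y⟫_ℝ = ⟪x, P.reflection i y⟫_ℝ := by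
  rw [hP.reflection_eq, hP.reflection_eq, inner_sub_left, inner_sub_right, real_inner_smul_left,
    real_inner_smul_right, hP.inner_coroot, real_inner_comm y (P.coroot i),
    hP.inner_coroot]
  ring

lemma inner_reflection_root (hP : IsEuclidean P) (i k : ι) (x : V) :
    ⟪P.reflection i x, P.root k⟫_ℝ = ⟪x, P.root (P.reflectionPerm i k)⟫_ℝ := by
  rw [hP.inner_reflection_left, P.root_reflectionPerm]

lemma inner_reflection_root_self (hP : IsEuclidean P) (i : ι) (x : V) :
    ⟪P.reflection i x, P.root i⟫_ℝ = -⟪x, P.root i⟫_ℝ := by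
  rw [hP.inner_reflection_left, P.reflection_apply_self, inner_neg_right]

end IsEuclidean

/-! ### Dominance, heights and the highest root. -/

/-- A vector is dominant when it pairs nonnegatively with the simple roots. -/
def IsDominant (b : P.Base) (x : V) : Prop := ∀ i ∈ b.support, 0 ≤ ⟪x, P.root i⟫_ℝ

lemma IsDominant.inner_root_nonneg {b : P.Base} {x : V} (hx : IsDominant b x) {k : ι}
    (hk : 0 < b.height k) : 0 ≤ ⟪x, P.root k⟫_ℝ := by
  obtain ⟨f, -, h | h⟩ := b.exists_root_eq_sum_nat_or_neg k
  · rw [h, inner_sum]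
    refine Finset.sum_nonneg fun i hi => ?_
    rw [← Nat.cast_smul_eq_nsmul ℝ, real_inner_smul_right]
    exact mul_nonneg (Nat.cast_nonneg _) (hx i hi)
  · have h1 : b.height k = ∑ i ∈ b.support, -(f i : ℤ) :=
      RootPairing.Base.height_eq_sum (by simpa using h)
    have h5 : 0 ≤ ∑ i ∈ b.support, (f i : ℤ) := Finset.sum_nonneg fun _ _ => by positivity
    rw [Finset.sum_neg_distrib] at h1
    omega

lemma IsHighestRoot.height_pos {b : P.Base} {ξ : ι} (hξ : IsHighestRoot b ξ) :
    0 < b.height ξ := by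
  have h2 := hξ (P.reflectionPerm ξ ξ)
  have h3 : b.height (P.reflectionPerm ξ ξ) = -b.height ξ := b.height_reflectionPerm_self ξ
  have h4 := b.height_ne_zero ξ
  omega

lemma inner_root_eq_sum_mark {b : P.Base} {ξ : ι} (hξ : IsHighestRoot b ξ) (x : V) :
    ⟪x, P.root ξ⟫_ℝ = ∑ i : b.support, (mark b ξ i : ℝ) * ⟪x, P.root i⟫_ℝ := by
  rw [root_eq_sum_mark b hξ, inner_sum]
  refine Finset.sum_congr rfl fun i _ => ?_
  rw [← Nat.cast_smul_eq_nsmul ℝ, real_inner_smul_right]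

lemma height_eq_neg_one_of_root_eq_neg {b : P.Base} {k i : ι} (hi : i ∈ b.support)
    (h : P.root k = -P.root i) : b.height k = -1 := by
  have h1 : k = P.reflectionPerm i i := by
    apply P.root.injective
    rw [h, P.root_reflectionPerm, P.reflection_apply_self]
  have h2 : b.height (P.reflectionPerm i i) = -b.height i := b.height_reflectionPerm_self i
  rw [h1, h2, RootPairing.Base.height_one_of_mem_support hi]

section Finite

variable [Finite ι] [P.IsCrystallographic]

/-- A positive root which pairs negatively with a simple root is not of maximal height. -/
lemma exists_root_eq_add_simple (hP : IsEuclidean P) {b : P.Base} {k i : ι}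
    (hk : 0 < b.height k) (hi : i ∈ b.support) (h : ⟪P.root k, P.root i⟫_ℝ < 0) :
    ∃ l, P.root l = P.root k + P.root i ∧ b.height l = b.height k + 1 := by
  obtain ⟨l, hl⟩ := P.root_add_root_mem_of_pairingIn_neg ((hP.pairingIn_neg_iff k i).mpr h)
    fun h' => by
      have := height_eq_neg_one_of_root_eq_neg hi h'
      omega
  exact ⟨l, hl, by rw [b.height_add hl, RootPairing.Base.height_one_of_mem_support hi]⟩

lemma IsHighestRoot.isDominant (hP : IsEuclidean P) {b : P.Base} {ξ : ι}
    (hξ : IsHighestRoot b ξ) : IsDominant b (P.root ξ) := by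
  intro i hi
  by_contra! h
  obtain ⟨l, -, hl⟩ := exists_root_eq_add_simple hP hξ.height_pos hi h
  have := hξ l
  omega

lemma inner_simple_nonpos (hP : IsEuclidean P) {b : P.Base} {i j : ι} (hi : i ∈ b.support)
    (hj : j ∈ b.support) (hij : i ≠ j) : ⟪P.root i, P.root j⟫_ℝ ≤ 0 := by
  by_contra! h
  exact absurd ((hP.pairingIn_pos_iff i j).mpr h) (b.pairingIn_le_zero_of_ne hij hi hj).not_gt

/-- If `mᵢ = 0`, then `⟨αᵢ, ξ⟩` is a sum of nonpositive terms, yet `ξ` is dominant, so every term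
vanishes. Thus the zero spreads to the neighbours of `αᵢ`, and by irreducibility to all marks,
forcing `ξ = 0`. -/
lemma IsHighestRoot.mark_pos [P.IsReduced] [P.IsIrreducible] (hP : IsEuclidean P) {b : P.Base}
    {ξ : ι} (hξ : IsHighestRoot b ξ) (i : b.support) : 0 < mark b ξ i := by
  by_contra! h0
  have key : ∀ j : b.support, mark b ξ j = 0 := by
    intro j
    refine RootPairing.Base.induction_on_cartanMatrix b (fun j => mark b ξ j = 0) (i := i)
      (by simpa using h0) ?_
    intro i j hi hij
    have hle : ∀ l ∈ Finset.univ,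
        (mark b ξ l : ℝ) * ⟪P.root i, P.root l⟫_ℝ ≤ 0 := by
      intro l _
      rcases eq_or_ne i l with rfl | hne
      · simp [hi]
      · exact mul_nonpos_of_nonneg_of_nonpos (Nat.cast_nonneg _)
          (inner_simple_nonpos hP i.2 l.2 fun h => hne (Subtype.ext h))
    have hsum : ∑ l : b.support, (mark b ξ l : ℝ) * ⟪P.root i, P.root l⟫_ℝ = 0 := by
      refine le_antisymm (Finset.sum_nonpos hle) ?_
      rw [← inner_root_eq_sum_mark hξ, real_inner_comm]
      exact hξ.isDominant hP i i.2
    have h := (Finset.sum_eq_zero_iff_of_nonpos hle).mp hsum j (Finset.mem_univ _)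
    rcases mul_eq_zero.mp h with h | h
    · exact_mod_cast h
    · refine absurd ?_ hij
      have h1 : (P.pairingIn ℤ j i : ℝ) = 0 := by
        rw [hP.pairingIn_eq, real_inner_comm (P.root i) (P.root j), h, mul_zero]
      exact_mod_cast h1
  have h := root_eq_sum_mark b hξ
  simp only [key, zero_smul, Finset.sum_const_zero] at h
  exact P.ne_zero ξ h

/-- The highest root dominates every root on the dominant chamber. -/
lemma IsHighestRoot.inner_root_le [P.IsRootSystem] [P.IsReduced] [P.IsIrreducible]
    (hP : IsEuclidean P) {b : P.Base} {ξ : ι} (hξ : IsHighestRoot b ξ) {x : V}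
    (hx : IsDominant b x) (k : ι) : ⟪x, P.root k⟫_ℝ ≤ ⟪x, P.root ξ⟫_ℝ := by
  induction hn : (b.height ξ - b.height k).toNat using Nat.strong_induction_on generalizing k with
  | _ n ih =>
    subst hn
    have hkξ := hξ k
    rcases lt_or_ge 0 (b.height k) with hk | hk
    -- A dominant positive root other than `ξ` pairs positively with `ξ`, so the difference is a
    -- root, positive by maximality of the height of `ξ`. A non-dominant one can be raised by a
    -- simple root.
    · by_cases hdom : IsDominant b (P.root k)
      · rcases eq_or_ne ξ k with rfl | hne
        · exact le_rfl
        have hpos : 0 < ⟪P.root ξ, P.root k⟫_ℝ := by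
          have hterm : ∀ l ∈ Finset.univ, 0 ≤ (mark b ξ l : ℝ) * ⟪P.root k, P.root l⟫_ℝ :=
            fun l _ => mul_nonneg (Nat.cast_nonneg _) (hdom l l.2)
          rw [real_inner_comm, inner_root_eq_sum_mark hξ]
          refine (Finset.sum_nonneg hterm).lt_of_ne' fun h => P.ne_zero k ?_
          refine InnerProductSpace.ext_inner_right_basis b.toWeightBasis fun l => ?_
          rw [RootPairing.Base.toWeightBasis_apply, inner_zero_left]
          have h' := (Finset.sum_eq_zero_iff_of_nonneg hterm).mp h l (Finset.mem_univ _)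
          exact (mul_eq_zero.mp h').resolve_left (by exact_mod_cast (hξ.mark_pos hP l).ne')
        obtain ⟨l, hl⟩ := P.root_sub_root_mem_of_pairingIn_pos
          ((hP.pairingIn_pos_iff ξ k).mpr hpos) hne
        have hl1 := b.height_sub hl
        have hl2 := b.height_ne_zero l
        have := hx.inner_root_nonneg (k := l) (by omega)
        rw [hl, inner_sub_right] at this
        linarith
      · simp only [IsDominant, not_forall, not_le] at hdom
        obtain ⟨i, hi, h⟩ := hdom
        obtain ⟨l, hl, hl'⟩ := exists_root_eq_add_simple hP hk hi h
        have hlξ := hξ l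
        have := ih _ (by omega) l rfl
        rw [hl, inner_add_right] at this
        linarith [hx i hi]
    · have h1 : b.height (P.reflectionPerm k k) = -b.height k := b.height_reflectionPerm_self k
      have h2 := b.height_ne_zero k
      have h3 := hx.inner_root_nonneg (k := P.reflectionPerm k k) (by omega)
      rw [P.root_reflectionPerm, P.reflection_apply_self, inner_neg_right] at h3
      linarith [hx.inner_root_nonneg hξ.height_pos]

end Finite

/-! ### The dual root lattice and its minuscule vectors. -/

lemma mem_dualRootLattice_iff {b : P.Base} {q : V} :
    q ∈ dualRootLattice b ↔ ∃ c : ι → ℤ, ∑ i ∈ b.support, c i • P.coroot i = q := by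
  rw [dualRootLattice, ← Submodule.span_int_eq_addSubgroupClosure, Submodule.mem_toAddSubgroup,
    Submodule.mem_span_image_finset_iff_exists_fun]
  constructor
  · classical
    rintro ⟨c, rfl⟩
    refine ⟨fun i => if h : i ∈ b.support then c ⟨i, h⟩ else 0, ?_⟩
    rw [← Finset.sum_coe_sort]
    simp
  · rintro ⟨c, rfl⟩
    exact ⟨fun i => c i, Finset.sum_coe_sort b.support fun i => c i • P.coroot i⟩

lemma exists_int_inner_root [P.IsCrystallographic] (hP : IsEuclidean P) {b : P.Base} {q : V}
    (hq : q ∈ dualRootLattice b) (k : ι) : ∃ z : ℤ, ⟪q, P.root k⟫_ℝ = z := by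
  obtain ⟨c, rfl⟩ := mem_dualRootLattice_iff.mp hq
  refine ⟨∑ i ∈ b.support, c i * P.pairingIn ℤ k i, ?_⟩
  rw [sum_inner]
  push_cast
  refine Finset.sum_congr rfl fun i _ => ?_
  rw [← Int.cast_smul_eq_zsmul ℝ, real_inner_smul_left, hP.inner_coroot_root]

lemma dualRootLattice_le_dualWeightLattice [P.IsCrystallographic] (hP : IsEuclidean P)
    (b : P.Base) : dualRootLattice b ≤ dualWeightLattice b :=
  fun _ hq k _ => exists_int_inner_root hP hq k

/-- No nonzero element of the dual root lattice is minuscule. -/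
lemma eq_zero_of_abs_inner_root_lt_two [P.IsCrystallographic] (hP : IsEuclidean P) {b : P.Base}
    {q : V} (hq : q ∈ dualRootLattice b) (h : ∀ k, |⟪q, P.root k⟫_ℝ| < 2) : q = 0 := by
  classical
  obtain ⟨c, hc⟩ := mem_dualRootLattice_iff.mp hq
  induction hn : ∑ i ∈ b.support, (c i).natAbs using Nat.strong_induction_on
    generalizing c q with
  | _ n ih =>
    subst hn
    by_contra hq0
    -- Descent on `∑ |cᵢ|`: as `⟨q, q⟩ > 0`, some `⟨q, αᵢ⟩ = ±1` has the sign of `cᵢ`, and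
    -- reflecting in `αᵢ` lowers `|cᵢ|` by one while keeping the bound on all roots.
    have hpos : 0 < ∑ i ∈ b.support, (c i : ℝ) * ⟪q, P.coroot i⟫_ℝ := by
      refine (real_inner_self_pos.mpr hq0).trans_eq ?_
      nth_rw 2 [← hc]
      rw [inner_sum]
      refine Finset.sum_congr rfl fun i _ => ?_
      rw [← Int.cast_smul_eq_zsmul ℝ, real_inner_smul_right]
    obtain ⟨i, hi, hci⟩ := Finset.exists_lt_of_sum_lt (s := b.support) (f := fun _ => (0 : ℝ))
      (by simpa using hpos)
    obtain ⟨z, hz⟩ := exists_int_inner_root hP hq i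
    have hcz : 0 < c i * z := by
      have h2 : 0 < 2 / ⟪P.root i, P.root i⟫_ℝ := div_pos two_pos (inner_root_self_pos P i)
      rw [hP.inner_coroot, hz, mul_left_comm] at hci
      exact_mod_cast (mul_pos_iff_of_pos_left h2).mp hci
    have hz2 : |z| < 2 := by
      have := h i
      rw [hz] at this
      exact_mod_cast this
    have hlt : (c i - z).natAbs < (c i).natAbs := by
      rw [abs_lt] at hz2
      have hz0 : z ≠ 0 := by rintro rfl; simp at hcz
      rcases (by omega : z = 1 ∨ z = -1) with rfl | rfl <;> omega
    have hsum : ∑ k ∈ b.support, (Function.update c i (c i - z)) k • P.coroot k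
        = P.reflection i q := by
      rw [hP.reflection_eq, hz, ← hc, ← Finset.add_sum_erase _ _ hi,
        ← Finset.add_sum_erase _ _ hi, Function.update_self, sub_smul, Int.cast_smul_eq_zsmul]
      rw [Finset.sum_congr rfl (g := fun k => c k • P.coroot k) fun k hk => by
        rw [Function.update_of_ne (Finset.ne_of_mem_erase hk)]]
      abel
    have hrefl : P.reflection i q = 0 := by
      refine ih _ ?_ (mem_dualRootLattice_iff.mpr ⟨_, hsum⟩)
        (fun k => by rw [hP.inner_reflection_root]; exact h _) _ hsum rfl
      refine Finset.sum_lt_sum (fun k _ => ?_) ⟨i, hi, by simpa using hlt⟩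
      rcases eq_or_ne k i with rfl | hk
      · simpa using hlt.le
      · simp [hk]
    exact hq0 (by simpa using hrefl)

/-! ### Geometry of `F` and `F^e`. -/

lemma interior_fundRegion (b : P.Base) (ξ : ι) : interior (fundRegion b ξ) =
    {a | (∀ i ∈ b.support, 0 < ⟪a, P.root i⟫_ℝ) ∧ ⟪a, P.root ξ⟫_ℝ < 1} := by
  have hcont (v : V) : Continuous fun a : V => ⟪a, v⟫_ℝ := by fun_prop
  -- Nonzero functionals are open maps, so interiors commute with preimages of half-lines.
  have hopen (k : ι) : IsOpenMap fun a : V => ⟪a, P.root k⟫_ℝ := by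
    let f : V →L[ℝ] ℝ := innerSL ℝ (P.root k)
    have hf : Function.Surjective f := by
      refine LinearMap.surjective (f := f.toLinearMap) fun h => ?_
      have := LinearMap.congr_fun h (P.root k)
      exact (inner_root_self_pos P k).ne' (by simpa [f] using this)
    have : (fun a : V => ⟪a, P.root k⟫_ℝ) = f := by
      ext a
      simp [f, real_inner_comm]
    rw [this]
    exact f.isOpenMap_of_finiteDimensional hf
  apply subset_antisymm
  · intro a ha
    refine ⟨fun i hi => ?_, ?_⟩
    · have h1 : a ∈ interior ((fun a : V => ⟪a, P.root i⟫_ℝ) ⁻¹' Set.Ici 0) :=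
        interior_mono (fun x hx => hx.1 i hi) ha
      rw [← (hopen i).preimage_interior_eq_interior_preimage (hcont _), interior_Ici] at h1
      exact h1
    · have h1 : a ∈ interior ((fun a : V => ⟪a, P.root ξ⟫_ℝ) ⁻¹' Set.Iic 1) :=
        interior_mono (fun x hx => hx.2) ha
      rw [← (hopen ξ).preimage_interior_eq_interior_preimage (hcont _), interior_Iic] at h1
      exact h1
  · refine interior_maximal (fun a ha => ⟨fun i hi => (ha.1 i hi).le, ha.2.le⟩) ?_
    have : {a : V | (∀ i ∈ b.support, 0 < ⟪a, P.root i⟫_ℝ) ∧ ⟪a, P.root ξ⟫_ℝ < 1} =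
        (⋂ i ∈ b.support, {a | 0 < ⟪a, P.root i⟫_ℝ}) ∩ {a | ⟪a, P.root ξ⟫_ℝ < 1} := by
      ext a
      simp
    rw [this]
    exact (isOpen_biInter_finset fun i _ => isOpen_lt continuous_const (hcont _)).inter
      (isOpen_lt (hcont _) continuous_const)

lemma disjoint_fundRegion_reflection (hP : IsEuclidean P) (b : P.Base) (ξ : ι) {j : ι}
    (hj : j ∈ b.support) :
    Disjoint (fundRegion b ξ) (P.reflection j '' interior (fundRegion b ξ)) := by
  rw [Set.disjoint_left]
  rintro _ hx ⟨y, hy, rfl⟩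
  rw [interior_fundRegion] at hy
  have h := hx.1 j hj
  rw [hP.inner_reflection_root_self] at h
  linarith [hy.1 j hj]

section Regions

variable [Finite ι] [P.IsCrystallographic] [P.IsRootSystem] [P.IsReduced] [P.IsIrreducible]
  {b : P.Base} {ξ j : ι}

lemma abs_inner_root_le (hP : IsEuclidean P) (hξ : IsHighestRoot b ξ) {x : V}
    (hx : IsDominant b x) (k : ι) : |⟪x, P.root k⟫_ℝ| ≤ ⟪x, P.root ξ⟫_ℝ := by
  have h := hξ.inner_root_le hP hx (P.reflectionPerm k k)
  rw [P.root_reflectionPerm, P.reflection_apply_self, inner_neg_right] at h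
  exact abs_le.mpr ⟨by linarith, hξ.inner_root_le hP hx k⟩

lemma inner_root_mem_Icc (hP : IsEuclidean P) (hξ : IsHighestRoot b ξ) {x : V}
    (hx : x ∈ fundRegion b ξ) {k : ι} (hk : 0 < b.height k) :
    ⟪x, P.root k⟫_ℝ ∈ Set.Icc 0 1 :=
  ⟨IsDominant.inner_root_nonneg hx.1 hk, (hξ.inner_root_le hP hx.1 k).trans hx.2⟩

/-- A positive root takes values in `[0, 1]` on `F`. The triangle inequality alone would give only
the bound 2, which is not strict. -/
lemma abs_inner_root_sub_le_one (hP : IsEuclidean P) (hξ : IsHighestRoot b ξ) {x y : V}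
    (hx : x ∈ fundRegion b ξ) (hy : y ∈ fundRegion b ξ) (k : ι) :
    |⟪x - y, P.root k⟫_ℝ| ≤ 1 := by
  have key (l : ι) (hl : 0 < b.height l) : |⟪x - y, P.root l⟫_ℝ| ≤ 1 := by
    have h1 := inner_root_mem_Icc hP hξ hx hl
    have h2 := inner_root_mem_Icc hP hξ hy hl
    rw [inner_sub_left, abs_le]
    exact ⟨by linarith [h1.1, h2.2], by linarith [h1.2, h2.1]⟩
  rcases lt_or_gt_of_ne (b.height_ne_zero k) with hk | hk
  · have h1 : b.height (P.reflectionPerm k k) = -b.height k := b.height_reflectionPerm_self k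
    have h2 := key (P.reflectionPerm k k) (by omega)
    rwa [P.root_reflectionPerm, P.reflection_apply_self, inner_neg_right, abs_neg] at h2
  · exact key k hk

lemma abs_inner_root_le_one (hP : IsEuclidean P) (hξ : IsHighestRoot b ξ) {x : V}
    (hx : x ∈ fundRegion b ξ) (k : ι) : |⟪x, P.root k⟫_ℝ| ≤ 1 :=
  (abs_inner_root_le hP hξ hx.1 k).trans hx.2

lemma abs_inner_root_lt_one (hP : IsEuclidean P) (hξ : IsHighestRoot b ξ) {x : V}
    (hx : x ∈ P.reflection j '' interior (fundRegion b ξ)) (k : ι) :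
    |⟪x, P.root k⟫_ℝ| < 1 := by
  obtain ⟨y, hy, rfl⟩ := hx
  rw [interior_fundRegion] at hy
  rw [hP.inner_reflection_root]
  exact (abs_inner_root_le hP hξ (fun i hi => (hy.1 i hi).le) _).trans_lt hy.2

/-- Representatives in `F^e` are unique. -/
lemma injOn_mk_evenFundRegion (hP : IsEuclidean P) (hξ : IsHighestRoot b ξ) (j : ι) :
    Set.InjOn (QuotientAddGroup.mk' (dualRootLattice b)) (evenFundRegion b ξ j) := by
  intro x hx y hy hxy
  have hq : x - y ∈ dualRootLattice b := by
    rw [← QuotientAddGroup.ker_mk' (dualRootLattice b), AddMonoidHom.mem_ker, map_sub, hxy,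
      sub_self]
  refine sub_eq_zero.mp (eq_zero_of_abs_inner_root_lt_two hP hq fun k => ?_)
  have htri : |⟪x - y, P.root k⟫_ℝ| ≤ |⟪x, P.root k⟫_ℝ| + |⟪y, P.root k⟫_ℝ| := by
    rw [inner_sub_left]
    exact abs_sub _ _
  -- As soon as one point lies in `r_j int(F)`, its strict bound makes the triangle inequality
  -- strict.
  rcases hx with hx | hx <;> rcases hy with hy | hy
  · linarith [abs_inner_root_sub_le_one hP hξ hx hy k]
  · linarith [abs_inner_root_le_one hP hξ hx k, abs_inner_root_lt_one hP hξ hy k]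
  · linarith [abs_inner_root_lt_one hP hξ hx k, abs_inner_root_le_one hP hξ hy k]
  · linarith [abs_inner_root_lt_one hP hξ hx k, abs_inner_root_lt_one hP hξ hy k]

end Regions

/-! ### Grid points and dominant elements of `P^∨`. -/

/-- The points of `(1/M)P^∨`, as vectors. -/
def gridPoints (b : P.Base) (M : ℕ) : Set V := {a | (M : ℝ) • a ∈ dualWeightLattice b}

/-- Since `Q^∨ ⊆ P^∨`, every representative of a grid coset is itself a grid point. -/
lemma gridIn_eq_image [P.IsCrystallographic] (hP : IsEuclidean P) (b : P.Base) {M : ℕ}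
    (hM : 0 < M) (S : Set V) :
    gridIn b M S = QuotientAddGroup.mk' (dualRootLattice b) '' (S ∩ gridPoints b M) := by
  have hM0 : (M : ℝ) ≠ 0 := by positivity
  have hmem (a : V) : a ∈ (M : ℝ)⁻¹ • dualWeightLattice b ↔ a ∈ gridPoints b M := by
    rw [AddSubgroup.mem_inv_pointwise_smul_iff₀ hM0]
    rfl
  ext q
  constructor
  · rintro ⟨⟨a, ha, rfl⟩, s, hs, hsa⟩
    refine ⟨s, ⟨hs, ?_⟩, hsa⟩
    have hq : s - a ∈ dualRootLattice b := by
      rw [← QuotientAddGroup.ker_mk' (dualRootLattice b), AddMonoidHom.mem_ker, map_sub, hsa,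
        sub_self]
    have hMq : (M : ℝ) • (s - a) ∈ dualWeightLattice b := by
      rw [Nat.cast_smul_eq_nsmul]
      exact nsmul_mem (dualRootLattice_le_dualWeightLattice hP b hq) M
    have := add_mem hMq ((hmem a).mp ha)
    rwa [← smul_add, sub_add_cancel] at this
  · rintro ⟨s, ⟨hs, hsM⟩, rfl⟩
    exact ⟨⟨s, (hmem s).mpr hsM, rfl⟩, s, hs, rfl⟩

lemma reflection_mem_dualWeightLattice [P.IsCrystallographic] (hP : IsEuclidean P) {b : P.Base}
    {j : ι} (hj : j ∈ b.support) {x : V} (hx : x ∈ dualWeightLattice b) :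
    P.reflection j x ∈ dualWeightLattice b := by
  obtain ⟨z, hz⟩ := hx j hj
  rw [hP.reflection_eq, hz, Int.cast_smul_eq_zsmul]
  refine sub_mem hx (zsmul_mem (dualRootLattice_le_dualWeightLattice hP b ?_) z)
  exact AddSubgroup.subset_closure (Set.mem_image_of_mem _ hj)

lemma reflection_mem_gridPoints_iff [P.IsCrystallographic] (hP : IsEuclidean P) {b : P.Base}
    {j : ι} (hj : j ∈ b.support) {M : ℕ} {x : V} :
    P.reflection j x ∈ gridPoints b M ↔ x ∈ gridPoints b M := by
  have key (y : V) (hy : y ∈ gridPoints b M) : P.reflection j y ∈ gridPoints b M := by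
    have := reflection_mem_dualWeightLattice hP hj hy
    rwa [map_smul] at this
  exact ⟨fun h => by simpa using key _ h, key x⟩

/-- The dominant elements `p` of `P^∨` of level `⟨p, ξ⟩ ≤ N`. -/
def dominantLevel (b : P.Base) (ξ : ι) (N : ℝ) : Set V :=
  {p | p ∈ dualWeightLattice b ∧ IsDominant b p ∧ ⟪p, P.root ξ⟫_ℝ ≤ N}

lemma fundRegion_inter_gridPoints (b : P.Base) (ξ : ι) {M : ℕ} (hM : 0 < M) :
    fundRegion b ξ ∩ gridPoints b M =
      (fun p : V => (M : ℝ)⁻¹ • p) '' dominantLevel b ξ M := by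
  have hM0 : (0 : ℝ) < M := by positivity
  ext a
  constructor
  · rintro ⟨ha, haM⟩
    refine ⟨(M : ℝ) • a, ⟨haM, fun i hi => ?_, ?_⟩, inv_smul_smul₀ hM0.ne' a⟩
    · rw [real_inner_smul_left]
      exact mul_nonneg hM0.le (ha.1 i hi)
    · rw [real_inner_smul_left]
      exact mul_le_of_le_one_right hM0.le ha.2
  · rintro ⟨p, ⟨hp, hd, hl⟩, rfl⟩
    refine ⟨⟨fun i hi => ?_, ?_⟩, ?_⟩
    · rw [real_inner_smul_left]
      exact mul_nonneg (inv_nonneg.mpr hM0.le) (hd i hi)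
    · rw [real_inner_smul_left]
      exact (inv_mul_le_one₀ hM0).mpr hl
    · change (M : ℝ) • (M : ℝ)⁻¹ • p ∈ dualWeightLattice b
      rwa [smul_inv_smul₀ hM0.ne']

/-- The simple roots form a basis; `ρ` represents the functional equal to 1 on each of them. -/
lemma exists_forall_inner_simple_eq_one [FiniteDimensional ℝ V] [P.IsRootSystem] (b : P.Base) :
    ∃ ρ : V, ∀ i ∈ b.support, ⟪ρ, P.root i⟫_ℝ = 1 := by
  let f : V →ₗ[ℝ] ℝ := b.toWeightBasis.constr ℝ fun _ => (1 : ℝ)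
  refine ⟨(InnerProductSpace.toDual ℝ V).symm (LinearMap.toContinuousLinearMap f),
    fun i hi => ?_⟩
  rw [InnerProductSpace.toDual_symm_apply, LinearMap.coe_toContinuousLinearMap',
    ← b.toWeightBasis_apply ⟨i, hi⟩, Module.Basis.constr_basis]

lemma inner_highest_eq_coxeterNumber_sub_one {b : P.Base} {ξ : ι} (hξ : IsHighestRoot b ξ) {ρ : V}
    (hρ : ∀ i ∈ b.support, ⟪ρ, P.root i⟫_ℝ = 1) :
    ⟪ρ, P.root ξ⟫_ℝ = coxeterNumber b ξ - 1 := by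
  rw [inner_root_eq_sum_mark hξ, coxeterNumber]
  simp [hρ]

lemma exists_int_inner_highest {b : P.Base} {ξ : ι} (hξ : IsHighestRoot b ξ) {p : V}
    (hp : p ∈ dualWeightLattice b) : ∃ z : ℤ, ⟪p, P.root ξ⟫_ℝ = z := by
  choose z hz using fun i : b.support => hp i i.2
  refine ⟨∑ i : b.support, mark b ξ i * z i, ?_⟩
  rw [inner_root_eq_sum_mark hξ]
  simp [hz]

lemma interior_fundRegion_inter_gridPoints {b : P.Base} {ξ : ι} (hξ : IsHighestRoot b ξ) {M : ℕ}
    (hM : 0 < M) {ρ : V} (hρ : ∀ i ∈ b.support, ⟪ρ, P.root i⟫_ℝ = 1) :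
    interior (fundRegion b ξ) ∩ gridPoints b M =
      (fun p : V => (M : ℝ)⁻¹ • (p + ρ)) '' dominantLevel b ξ (M - coxeterNumber b ξ) := by
  have hM0 : (0 : ℝ) < M := by positivity
  have hρP : ρ ∈ dualWeightLattice b := fun i hi => ⟨1, by simp [hρ i hi]⟩
  have hρξ := inner_highest_eq_coxeterNumber_sub_one hξ hρ
  rw [interior_fundRegion]
  ext a
  constructor
  · rintro ⟨ha, haM⟩
    have hp : (M : ℝ) • a - ρ ∈ dualWeightLattice b := sub_mem haM hρP
    refine ⟨(M : ℝ) • a - ρ, ⟨hp, fun i hi => ?_, ?_⟩, ?_⟩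
    · obtain ⟨z, hz⟩ := haM i hi
      have h1 := mul_pos hM0 (ha.1 i hi)
      rw [← real_inner_smul_left, hz] at h1
      rw [inner_sub_left, hρ i hi, hz, sub_nonneg]
      have h2 : 0 < z := by exact_mod_cast h1
      exact_mod_cast h2
    · obtain ⟨z, hz⟩ := exists_int_inner_highest hξ haM
      have h1 := mul_lt_mul_of_pos_left ha.2 hM0
      rw [← real_inner_smul_left, hz, mul_one] at h1
      rw [inner_sub_left, hρξ, hz]
      -- Integrality turns `z < M` into `z ≤ M - 1`; subtracting `⟨ρ, ξ⟩ = m - 1` leaves `M - m`.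
      have h2 : z + 1 ≤ M := by exact_mod_cast h1
      have h3 : (z : ℝ) + 1 ≤ M := by exact_mod_cast h2
      linarith
    · simp [inv_smul_smul₀ hM0.ne']
  · rintro ⟨p, ⟨hp, hd, hl⟩, rfl⟩
    refine ⟨⟨fun i hi => ?_, ?_⟩, ?_⟩
    · rw [real_inner_smul_left, inner_add_left, hρ i hi]
      have := hd i hi
      positivity
    · rw [real_inner_smul_left, inner_add_left, hρξ, inv_mul_lt_one₀ hM0]
      linarith
    · change (M : ℝ) • (M : ℝ)⁻¹ • (p + ρ) ∈ dualWeightLattice b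
      rw [smul_inv_smul₀ hM0.ne']
      exact add_mem hp hρP

lemma dominantLevel_eq_empty {b : P.Base} {ξ : ι} (hξ : IsHighestRoot b ξ) {N : ℝ} (hN : N < 0) :
    dominantLevel b ξ N = ∅ := by
  refine Set.eq_empty_of_forall_notMem fun p hp => ?_
  linarith [hp.2.1.inner_root_nonneg hξ.height_pos, hp.2.2]

lemma ncard_fundRegion_inter_gridPoints (b : P.Base) (ξ : ι) {M : ℕ} (hM : 0 < M) :
    (fundRegion b ξ ∩ gridPoints b M).ncard = (dominantLevel b ξ M).ncard := by
  rw [fundRegion_inter_gridPoints b ξ hM]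
  exact Set.ncard_image_of_injective _ (smul_right_injective V (by positivity))

lemma evenFundRegion_inter_gridPoints [P.IsCrystallographic] (hP : IsEuclidean P) {b : P.Base}
    (ξ : ι) {j : ι} (hj : j ∈ b.support) (M : ℕ) :
    evenFundRegion b ξ j ∩ gridPoints b M = fundRegion b ξ ∩ gridPoints b M ∪
      P.reflection j '' (interior (fundRegion b ξ) ∩ gridPoints b M) := by
  rw [evenFundRegion, Set.union_inter_distrib_right]
  congr 1
  ext a
  constructor
  · rintro ⟨⟨y, hy, rfl⟩, h⟩
    exact ⟨y, ⟨hy, (reflection_mem_gridPoints_iff hP hj).mp h⟩, rfl⟩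
  · rintro ⟨y, ⟨hy, h⟩, rfl⟩
    exact ⟨⟨y, hy, rfl⟩, (reflection_mem_gridPoints_iff hP hj).mpr h⟩

/-! ### Finiteness and counting. -/

section Finite

variable [Finite ι] [P.IsCrystallographic] [P.IsRootSystem] [P.IsReduced] [P.IsIrreducible]
  {b : P.Base} {ξ : ι}

lemma dominantLevel_zero (hP : IsEuclidean P) (hξ : IsHighestRoot b ξ) :
    dominantLevel b ξ 0 = {0} := by
  ext p
  rw [Set.mem_singleton_iff]
  constructor
  · rintro ⟨-, hd, hl⟩
    refine InnerProductSpace.ext_inner_right_basis b.toWeightBasis fun i => ?_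
    rw [RootPairing.Base.toWeightBasis_apply, inner_zero_left]
    exact le_antisymm ((hξ.inner_root_le hP hd i).trans hl) (hd i i.2)
  · rintro rfl
    exact ⟨zero_mem _, fun i _ => by simp, by simp⟩

/-- Pairings with the simple roots determine `p`, and each is an integer between 0 and `N` because
`ξ` dominates the simple roots. -/
lemma finite_dominantLevel (hP : IsEuclidean P) (hξ : IsHighestRoot b ξ) (N : ℝ) :
    (dominantLevel b ξ N).Finite := by
  let φ : V → b.support → ℝ := fun p i => ⟪p, P.root i⟫_ℝ
  have hφ : Function.Injective φ := fun x y h => by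
    refine InnerProductSpace.ext_inner_right_basis b.toWeightBasis fun i => ?_
    rw [RootPairing.Base.toWeightBasis_apply]
    exact congrFun h i
  have hfin : (Set.univ.pi fun _ : b.support =>
      ((↑) : ℤ → ℝ) '' Set.Icc 0 ⌊N⌋).Finite :=
    Set.Finite.pi fun _ => (Set.finite_Icc _ _).image _
  refine (hfin.preimage hφ.injOn).subset fun p hp i _ => ?_
  obtain ⟨z, hz⟩ := hp.1 i i.2
  refine ⟨z, ⟨?_, Int.le_floor.mpr ?_⟩, hz.symm⟩
  · have := hp.2.1 i i.2
    rw [hz] at this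
    exact_mod_cast this
  · rw [← hz]
    exact (hξ.inner_root_le hP hp.2.1 i).trans hp.2.2

lemma finite_grid (hP : IsEuclidean P) (hξ : IsHighestRoot b ξ) {M : ℕ} (hM : 0 < M) :
    (grid b ξ M).Finite := by
  rw [grid, gridIn_eq_image hP b hM, fundRegion_inter_gridPoints b ξ hM]
  exact ((finite_dominantLevel hP hξ _).image _).image _

lemma ncard_grid (hP : IsEuclidean P) (hξ : IsHighestRoot b ξ) {M : ℕ} (hM : 0 < M) :
    (grid b ξ M).ncard = (dominantLevel b ξ M).ncard := by
  rw [grid, gridIn_eq_image hP b hM, Set.InjOn.ncard_image,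
    ncard_fundRegion_inter_gridPoints b ξ hM]
  exact (injOn_mk_evenFundRegion hP hξ ξ).mono
    (Set.inter_subset_left.trans Set.subset_union_left)

variable [FiniteDimensional ℝ V]

lemma finite_evenGrid (hP : IsEuclidean P) (hξ : IsHighestRoot b ξ) {j : ι} (hj : j ∈ b.support)
    {M : ℕ} (hM : 0 < M) : (evenGrid b ξ j M).Finite := by
  obtain ⟨ρ, hρ⟩ := exists_forall_inner_simple_eq_one b
  rw [evenGrid, gridIn_eq_image hP b hM, evenFundRegion_inter_gridPoints hP ξ hj,
    fundRegion_inter_gridPoints b ξ hM, interior_fundRegion_inter_gridPoints hξ hM hρ]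
  exact (((finite_dominantLevel hP hξ _).image _).union
    (((finite_dominantLevel hP hξ _).image _).image _)).image _

lemma ncard_evenGrid (hP : IsEuclidean P) (hξ : IsHighestRoot b ξ) {j : ι} (hj : j ∈ b.support)
    {M : ℕ} (hM : 0 < M) : (evenGrid b ξ j M).ncard =
      (grid b ξ M).ncard + (dominantLevel b ξ (M - coxeterNumber b ξ)).ncard := by
  obtain ⟨ρ, hρ⟩ := exists_forall_inner_simple_eq_one b
  have hF : (fundRegion b ξ ∩ gridPoints b M).Finite := by
    rw [fundRegion_inter_gridPoints b ξ hM]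
    exact (finite_dominantLevel hP hξ _).image _
  have hI : (interior (fundRegion b ξ) ∩ gridPoints b M).Finite :=
    hF.subset (Set.inter_subset_inter_left _ interior_subset)
  have hinj : Function.Injective fun p : V => (M : ℝ)⁻¹ • (p + ρ) :=
    (smul_right_injective V (by positivity)).comp (add_left_injective ρ)
  rw [evenGrid, gridIn_eq_image hP b hM, Set.InjOn.ncard_image
      ((injOn_mk_evenFundRegion hP hξ j).mono Set.inter_subset_left),
    evenFundRegion_inter_gridPoints hP ξ hj, Set.ncard_union_eq _ hF (hI.image _),
    Set.ncard_image_of_injective _ (P.reflection j).injective,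
    ncard_fundRegion_inter_gridPoints b ξ hM, ncard_grid hP hξ hM,
    interior_fundRegion_inter_gridPoints hξ hM hρ, Set.ncard_image_of_injective _ hinj]
  exact (disjoint_fundRegion_reflection hP b ξ hj).mono Set.inter_subset_left
    (Set.image_mono Set.inter_subset_left)

end Finite

end EvenGrid

theorem mainTheorem2 {ι V : Type*} [Finite ι]
    [NormedAddCommGroup V] [InnerProductSpace ℝ V] [FiniteDimensional ℝ V]
    (P : RootPairing ι ℝ V V) [P.IsRootSystem] [P.IsCrystallographic] [P.IsReduced]
    [P.IsIrreducible] (hP : EvenGrid.IsEuclidean P)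
    (b : P.Base) (ξ : ι) (hξ : EvenGrid.IsHighestRoot b ξ)
    (j : ι) (hj : j ∈ b.support) (M : ℕ) (hM : 0 < M) :
    (EvenGrid.evenGrid b ξ j M).Finite ∧
    (EvenGrid.grid b ξ M).Finite ∧
    (EvenGrid.evenGrid b ξ j M).ncard =
      if M < EvenGrid.coxeterNumber b ξ then
        (EvenGrid.grid b ξ M).ncard
      else if M = EvenGrid.coxeterNumber b ξ then
        (EvenGrid.grid b ξ M).ncard + 1
      else
        (EvenGrid.grid b ξ M).ncard + (EvenGrid.grid b ξ (M - EvenGrid.coxeterNumber b ξ)).ncard := by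
  refine ⟨EvenGrid.finite_evenGrid hP hξ hj hM, EvenGrid.finite_grid hP hξ hM, ?_⟩
  rw [EvenGrid.ncard_evenGrid hP hξ hj hM]
  split_ifs with hlt heq
  · have h : (M : ℝ) - EvenGrid.coxeterNumber b ξ < 0 := sub_neg.mpr (by exact_mod_cast hlt)
    rw [EvenGrid.dominantLevel_eq_empty hξ h, Set.ncard_empty, add_zero]
  · rw [← heq, sub_self, EvenGrid.dominantLevel_zero hP hξ, Set.ncard_singleton]
  -- Here `M - m` is positive, so it is itself a valid grid size.
  · have hle : EvenGrid.coxeterNumber b ξ ≤ M := not_lt.mp hlt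
    rw [EvenGrid.ncard_grid hP hξ (M := M - EvenGrid.coxeterNumber b ξ) (by omega),
      Nat.cast_sub hle]
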